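/- Diagonal-circulant neural networks of bounded width are universal approximators in the following sense. Let $\rho(z)=\max(0,\operatorname{Re} z)+\mathbf{i}\max(0,\operatorname{Im} z)$ be the complex ReLU function, applied coordinatewise to vectors. A complex diagonal-circulant neural network of width $m$ and depth $p\ge 1$ is a function $N:\mathbb{C}^m\to\mathbb{C}^m$ of the form $N=\phi_p\circ\cdots\circ\phi_1$ with layers $\phi_i(x)=\rho\big(D^{(i)}C^{(i)}x+b^{(i)}\big)$, where $D^{(i)}\in\mathbb{C}^{m\times m}$ is diagonal, $C^{(i)}\in\mathbb{C}^{m\times m}$ is circulant and $b^{(i)}\in\mathbb{C}^m$. For every $n\in\mathbb{N}$, every continuous function $f:[0,1]^n\to\mathbb{R}_+=[0,\infty)$ and every $\varepsilon>0$, there exists a complex diagonal-circulant neural network $N$ of width $n+3$ (and of some finite depth $p \ge 1$) such that for all $x=(x_1,\dots,x_{n+3})\in[0,1]^{n+3}$, $$\big|f(x_1,\dots,x_n)-\big(N(x)\big)_1\big|<\varepsilon,$$ where $(N(x))_1\in\mathbb{C}$ is the first coordinate of the output $N(x)$ and $|\cdot|$ is the complex modulus. -/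

import Mathlib

noncomputable section

/-- The complex ReLU function: `z ↦ max(0, Re z) + i max(0, Im z)`. -/
def complexReLU (z : ℂ) : ℂ :=
  (max 0 z.re : ℝ) + Complex.I * (max 0 z.im : ℝ)

/-- The parameters `(D, C, b)` of one diagonal-circulant layer of width `m`: a complex diagonal
matrix `D`, given by its diagonal, a complex circulant matrix `C`, given by its first column,
and a complex bias vector `b`. -/
structure DCLayer (m : ℕ) where
  diag : Fin m → ℂ
  circ : Fin m → ℂ
  bias : Fin m → ℂ

namespace DCLayer

/-- The weight matrix `D * C` of the layer. -/
def weight {m : ℕ} (L : DCLayer m) : Matrix (Fin m) (Fin m) ℂ :=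
  Matrix.diagonal L.diag * Matrix.circulant L.circ

/-- The map `x ↦ ρ (D C x + b)` of the layer, `ρ` the complex ReLU applied to each coordinate. -/
def apply {m : ℕ} (L : DCLayer m) (x : Fin m → ℂ) : Fin m → ℂ :=
  fun i => complexReLU ((L.weight.mulVec x + L.bias) i)

end DCLayer

/-- The parameters of a diagonal-circulant neural network of width `m`: the list of its layers,
the first layer at the head. The depth of the network is the length of the list. -/
abbrev DCNetwork (m : ℕ) : Type := List (DCLayer m)

/-- The function of the network with layers `[L₁, …, Lₚ]`: the composition `Lₚ ∘ ⋯ ∘ L₁`. -/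
def DCNetwork.eval {m : ℕ} (N : DCNetwork m) (x : Fin m → ℂ) : Fin m → ℂ :=
  List.foldl (fun z L => DCLayer.apply L z) x N

end

/-! On the cube, `f` is uniformly close to a finite sum of terms `a * max 0 (w ⬝ᵥ x + b)`, and
narrow networks can add up such sums one term at a time. Density (`topologicalClosure_reluSpan`)
follows from Stone–Weierstrass for exponentials, which are integrals of ReLU ridge functions. For
the networks, a large bias moves a compact set into the first quadrant, where ρ is the identity; so
affine layers come for free up to a translation, and `DCApproximable` is closed under composition.
Diagonal scalings and shifts then give `transvection` in the limit, hence a register machine: the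
inputs stay in place, one register evaluates a neuron, another accumulates. A last layer undoes the
translation; its ρ does no harm because `f` is nonnegative. -/

noncomputable section

open Filter Topology

/-! ### Density of the span of ReLU ridge functions -/

/-- The unit cube of `ℝⁿ`. -/
abbrev unitCube (n : ℕ) : Type := Set.Icc (0 : Fin n → ℝ) 1

/-- The ridge function `x ↦ max 0 (w ⬝ x + b)` on the unit cube. -/
def reluRidge {n : ℕ} (w : Fin n → ℝ) (b : ℝ) : C(unitCube n, ℝ) where
  toFun x := max 0 (w ⬝ᵥ x.1 + b)
  continuous_toFun := continuous_const.max
    ((continuous_const.dotProduct continuous_subtype_val).add continuous_const)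

/-- The ridge function `x ↦ exp (w ⬝ x)` on the unit cube. -/
def expRidge {n : ℕ} (w : Fin n → ℝ) : C(unitCube n, ℝ) where
  toFun x := Real.exp (w ⬝ᵥ x.1)
  continuous_toFun := Real.continuous_exp.comp
    (continuous_const.dotProduct continuous_subtype_val)

/-- The span of the ReLU ridge functions on the unit cube. -/
def reluSpan (n : ℕ) : Submodule ℝ C(unitCube n, ℝ) :=
  Submodule.span ℝ (Set.range fun p : (Fin n → ℝ) × ℝ => reluRidge p.1 p.2)

theorem reluRidge_mem_reluSpan {n : ℕ} (w : Fin n → ℝ) (b : ℝ) :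
    reluRidge w b ∈ reluSpan n :=
  Submodule.subset_span ⟨(w, b), rfl⟩

theorem continuous_reluRidge {n : ℕ} (w : Fin n → ℝ) :
    Continuous fun b : ℝ => reluRidge w b := by
  refine ContinuousMap.continuous_of_continuous_uncurry _ ?_
  change Continuous fun p : ℝ × unitCube n => max 0 (w ⬝ᵥ p.2.1 + p.1)
  exact continuous_const.max ((continuous_const.dotProduct
    (continuous_subtype_val.comp continuous_snd)).add continuous_fst)

/-- Taylor's formula at `A` with integral remainder. The `max` cuts the integral off at `t`, so its
limits do not depend on `t`. -/
theorem exp_eq_integral_relu {A B t : ℝ} (hA : A ≤ t) (hB : t ≤ B) :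
    Real.exp t = (∫ u in A..B, Real.exp u * max 0 (t + -u)) + Real.exp A * max 0 (t + -A)
      + Real.exp A := by
  have hc : Continuous fun u : ℝ => Real.exp u * max 0 (t + -u) := by fun_prop
  have h₁ : ∫ u in A..t, Real.exp u * max 0 (t + -u)
      = (t - t + 1) * Real.exp t - (t - A + 1) * Real.exp A := by
    rw [← intervalIntegral.integral_eq_sub_of_hasDerivAt
      (f := fun u => (t - u + 1) * Real.exp u) (f' := fun u => Real.exp u * (t + -u))
      (fun u _ => ?_) (Continuous.intervalIntegrable (by fun_prop) _ _)]
    · refine intervalIntegral.integral_congr fun u hu => ?_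
      rw [Set.uIcc_of_le hA] at hu
      rw [max_eq_right (by linarith [hu.2])]
    · have := (((hasDerivAt_id u).const_sub t).add_const 1).mul (Real.hasDerivAt_exp u)
      exact this.congr_deriv (by simp only [id]; ring)
  have h₂ : ∫ u in t..B, Real.exp u * max 0 (t + -u) = 0 := by
    refine (intervalIntegral.integral_congr (g := fun _ => (0 : ℝ)) fun u hu => ?_).trans
      intervalIntegral.integral_zero
    rw [Set.uIcc_of_le hB] at hu
    simp [max_eq_left (show t + -u ≤ 0 by linarith [hu.1])]
  rw [← intervalIntegral.integral_add_adjacent_intervals (hc.intervalIntegrable A t)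
    (hc.intervalIntegrable t B), h₁, h₂, max_eq_right (by linarith)]
  ring

/-- A closed subspace contains the interval integrals of the continuous functions with values
in it. -/
theorem Submodule.intervalIntegral_mem {E : Type*} [NormedAddCommGroup E] [NormedSpace ℝ E]
    [CompleteSpace E] {W : Submodule ℝ E} (hW : IsClosed (W : Set E)) {f : ℝ → E}
    (hf : Continuous f) (hfW : ∀ u, f u ∈ W) {a b : ℝ} (hab : a < b) :
    ∫ u in a..b, f u ∈ W := by
  have havg : (⨍ u in Set.Ioc a b, f u) ∈ (W : Set E) := by
    refine W.convex.set_average_mem hW ?_ ?_ (Eventually.of_forall hfW) ?_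
    · simp [hab]
    · simp
    · exact (hf.intervalIntegrable a b).1
  rw [MeasureTheory.setAverage_eq] at havg
  have h := W.smul_mem (b - a) havg
  rw [smul_smul, Real.volume_real_Ioc_of_le hab.le, mul_inv_cancel₀ (sub_pos.2 hab).ne',
    one_smul] at h
  rwa [intervalIntegral.integral_of_le hab.le]

theorem expRidge_mem_topologicalClosure_reluSpan {n : ℕ} (w : Fin n → ℝ) :
    expRidge w ∈ (reluSpan n).topologicalClosure := by
  obtain ⟨R, hR⟩ : ∃ R : ℝ, ∀ x : unitCube n, |w ⬝ᵥ x.1| ≤ R := by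
    refine ⟨∑ i, |w i|, fun x => (Finset.abs_sum_le_sum_abs _ _).trans
      (Finset.sum_le_sum fun i _ => ?_)⟩
    rw [abs_mul]
    refine mul_le_of_le_one_right (abs_nonneg _) ?_
    exact abs_le.2 ⟨by linarith [show (0 : ℝ) ≤ x.1 i from x.2.1 i], x.2.2 i⟩
  have hRpos : 0 ≤ R := (abs_nonneg _).trans (hR ⟨0, by simp⟩)
  have hcont : Continuous fun u : ℝ => Real.exp u • reluRidge w (-u) :=
    Real.continuous_exp.smul ((continuous_reluRidge w).comp continuous_neg)
  have hmem : ∀ c b v, c • reluRidge v b ∈ (reluSpan n).topologicalClosure := fun c b v =>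
    Submodule.le_topologicalClosure _ (Submodule.smul_mem _ _ (reluRidge_mem_reluSpan v b))
  -- The constant term is the ridge function with weight `0` and bias `1`. The limit `R + 1` keeps
  -- the interval nondegenerate when `R = 0`.
  have key : expRidge w = (∫ u in (-R)..(R + 1), Real.exp u • reluRidge w (-u))
      + Real.exp (-R) • reluRidge w (- -R) + Real.exp (-R) • reluRidge 0 1 := by
    ext x
    have hx := abs_le.1 (hR x)
    have hint := ContinuousLinearMap.intervalIntegral_comp_comm
      (ContinuousMap.evalCLM ℝ x) (hcont.intervalIntegrable (μ := MeasureTheory.volume) (-R) (R + 1))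
    simp only [ContinuousMap.evalCLM_apply] at hint
    rw [ContinuousMap.add_apply, ContinuousMap.add_apply, ← hint]
    have h := exp_eq_integral_relu (t := w ⬝ᵥ x.1) (A := -R) (B := R + 1) hx.1 (by linarith)
    simpa [expRidge, reluRidge] using h
  rw [key]
  refine Submodule.add_mem _ (Submodule.add_mem _ ?_ (hmem _ _ _)) (hmem _ _ _)
  exact Submodule.intervalIntegral_mem (Submodule.isClosed_topologicalClosure _) hcont
    (fun u => hmem _ _ _) (by linarith)

/-- Exponential ridge functions are closed under products, so the algebra they generate is merely
their linear span; it separates points. -/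
theorem topologicalClosure_reluSpan (n : ℕ) : (reluSpan n).topologicalClosure = ⊤ := by
  let S : Submonoid C(unitCube n, ℝ) :=
    { carrier := Set.range expRidge
      one_mem' := ⟨0, by ext x; simp [expRidge]⟩
      mul_mem' := by
        rintro _ _ ⟨v, rfl⟩ ⟨w, rfl⟩
        exact ⟨v + w, by ext x; simp [expRidge, Real.exp_add, add_dotProduct]⟩ }
  have hle : Subalgebra.toSubmodule (Algebra.adjoin ℝ (S : Set C(unitCube n, ℝ)))
      ≤ (reluSpan n).topologicalClosure := by
    rw [Algebra.adjoin_eq_span, Submonoid.closure_eq, Submodule.span_le]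
    rintro _ ⟨w, rfl⟩
    exact expRidge_mem_topologicalClosure_reluSpan w
  have hsep : (Algebra.adjoin ℝ (S : Set C(unitCube n, ℝ))).SeparatesPoints := by
    intro x y hxy
    obtain ⟨i, hi⟩ := Function.ne_iff.1 (fun h => hxy (Subtype.ext h) : x.1 ≠ y.1)
    refine ⟨_, ⟨expRidge (Pi.single i 1), Algebra.subset_adjoin ⟨_, rfl⟩, rfl⟩, ?_⟩
    simpa [expRidge] using hi
  refine eq_top_iff.2 fun f _ => ?_
  have hf := ContinuousMap.continuousMap_mem_subalgebra_closure_of_separatesPoints _ hsep f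
  exact closure_minimal (fun g hg => hle hg) (Submodule.isClosed_topologicalClosure _) hf


/-! ### Maps approximable by diagonal-circulant networks -/

theorem complexReLU_eq (z : ℂ) : complexReLU z = ⟨max 0 z.re, max 0 z.im⟩ := by
  apply Complex.ext <;> simp [complexReLU]

theorem complexReLU_ofReal (r : ℝ) : complexReLU (r : ℂ) = ((max 0 r : ℝ) : ℂ) := by
  simp [complexReLU]

theorem continuous_complexReLU : Continuous complexReLU := by
  unfold complexReLU
  fun_prop

/-- `complexReLU` is the identity on the first quadrant. -/
theorem complexReLU_of_nonneg {z : ℂ} (hre : 0 ≤ z.re) (him : 0 ≤ z.im) : complexReLU z = z := by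
  rw [complexReLU_eq, max_eq_right hre, max_eq_right him]

theorem complexReLU_add_of_norm_le {z : ℂ} {M : ℝ} (h : ‖z‖ ≤ M) :
    complexReLU (z + ⟨M, M⟩) = z + ⟨M, M⟩ := by
  have hre := abs_le.1 ((Complex.abs_re_le_norm z).trans h)
  have him := abs_le.1 ((Complex.abs_im_le_norm z).trans h)
  apply complexReLU_of_nonneg
  · simp only [Complex.add_re]; linarith
  · simp only [Complex.add_im]; linarith

variable {m : ℕ}

namespace DCNetwork

theorem eval_nil (x : Fin m → ℂ) : eval ([] : DCNetwork m) x = x := rfl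

theorem eval_cons (L : DCLayer m) (N : DCNetwork m) (x : Fin m → ℂ) :
    eval (L :: N) x = eval N (L.apply x) := rfl

theorem eval_append (N N' : DCNetwork m) (x : Fin m → ℂ) :
    eval (N ++ N') x = eval N' (eval N x) :=
  List.foldl_append

theorem eval_singleton (L : DCLayer m) (x : Fin m → ℂ) : eval [L] x = L.apply x := rfl

/-- A translation of the input of a network can be absorbed by its first bias, up to a translation
of the output. -/
theorem exists_eval_eq_eval_sub (N : DCNetwork m) (c : Fin m → ℂ) :
    ∃ (N' : DCNetwork m) (d : Fin m → ℂ), ∀ x, eval N' x = eval N (x - c) + d := by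
  cases N with
  | nil => exact ⟨[], c, fun x => by simp [eval_nil]⟩
  | cons L N =>
    refine ⟨⟨L.diag, L.circ, L.bias - L.weight.mulVec c⟩ :: N, 0, fun x => ?_⟩
    rw [eval_cons, eval_cons, add_zero]
    congr 1
    ext i
    simp only [DCLayer.apply, DCLayer.weight, Matrix.mulVec_sub]
    refine congrArg complexReLU (congrFun ?_ i)
    abel

end DCNetwork

/-- The continuous maps which, up to a translation, are limits of networks, uniformly on compact
sets. -/
structure DCApproximable (g : (Fin m → ℂ) → Fin m → ℂ) : Prop where
  continuous : Continuous g
  exists_eval_near : ∀ K : Set (Fin m → ℂ), IsCompact K → ∀ ε > 0,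
    ∃ (N : DCNetwork m) (c : Fin m → ℂ), ∀ x ∈ K, ‖DCNetwork.eval N x - (g x + c)‖ < ε

namespace DCApproximable

theorem comp {h g : (Fin m → ℂ) → Fin m → ℂ} (hh : DCApproximable h) (hg : DCApproximable g) :
    DCApproximable fun x => h (g x) := by
  refine ⟨hh.continuous.comp hg.continuous, fun K hK ε hε => ?_⟩
  set K' := Metric.cthickening 1 (g '' K) with hK'
  have hKc : IsCompact K' := (hK.image hg.continuous).cthickening
  obtain ⟨δ, hδ, hunif⟩ := Metric.uniformContinuousOn_iff.1
    (hKc.uniformContinuousOn_of_continuous hh.continuous.continuousOn) (ε / 2) (half_pos hε)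
  obtain ⟨N, c, hN⟩ := hg.exists_eval_near K hK (min δ 1) (lt_min hδ one_pos)
  obtain ⟨P, d, hP⟩ := hh.exists_eval_near K' hKc (ε / 2) (half_pos hε)
  obtain ⟨P', d', hP'⟩ := DCNetwork.exists_eval_eq_eval_sub P c
  refine ⟨N ++ P', d + d', fun x hx => ?_⟩
  have hdist : dist (DCNetwork.eval N x - c) (g x) < min δ 1 := by
    rw [dist_eq_norm, sub_sub, add_comm c]
    exact hN x hx
  have hgx : g x ∈ K' := Metric.self_subset_cthickening _ ⟨x, hx, rfl⟩
  have hy : DCNetwork.eval N x - c ∈ K' :=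
    Metric.mem_cthickening_of_dist_le _ (g x) _ _ ⟨x, hx, rfl⟩
      (hdist.le.trans (min_le_right _ _))
  have h₁ := hunif _ hy _ hgx (hdist.trans_le (min_le_left _ _))
  have h₂ := hP _ hy
  rw [dist_eq_norm] at h₁
  rw [DCNetwork.eval_append, hP']
  calc _ = ‖(DCNetwork.eval P (DCNetwork.eval N x - c) - (h (DCNetwork.eval N x - c) + d))
        + (h (DCNetwork.eval N x - c) - h (g x))‖ := by congr 1; abel
    _ < ε / 2 + ε / 2 := (norm_add_le _ _).trans_lt (add_lt_add h₂ h₁)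
    _ = ε := add_halves ε

theorem of_forall_exists_near {g : (Fin m → ℂ) → Fin m → ℂ} (hg : Continuous g)
    (h : ∀ K : Set (Fin m → ℂ), IsCompact K → ∀ ε > 0,
      ∃ g', DCApproximable g' ∧ ∀ x ∈ K, ‖g' x - g x‖ < ε) : DCApproximable g := by
  refine ⟨hg, fun K hK ε hε => ?_⟩
  obtain ⟨g', hg', hnear⟩ := h K hK (ε / 2) (half_pos hε)
  obtain ⟨N, c, hN⟩ := hg'.exists_eval_near K hK (ε / 2) (half_pos hε)
  refine ⟨N, c, fun x hx => ?_⟩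
  calc _ = ‖(DCNetwork.eval N x - (g' x + c)) + (g' x - g x)‖ := by congr 1; abel
    _ < ε / 2 + ε / 2 := (norm_add_le _ _).trans_lt (add_lt_add (hN x hx) (hnear x hx))
    _ = ε := add_halves ε

/-- The affine maps `x ↦ D C x + b` are approximable. -/
theorem affine (L : DCLayer m) : DCApproximable fun x => L.weight.mulVec x + L.bias := by
  have hcont : Continuous fun x => L.weight.mulVec x + L.bias :=
    (continuous_const.matrix_mulVec continuous_id).add continuous_const
  refine ⟨hcont, fun K hK ε hε => ?_⟩
  obtain ⟨M, hM⟩ := (hK.image hcont).isBounded.exists_norm_le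
  let c : Fin m → ℂ := fun _ => ⟨M, M⟩
  refine ⟨[⟨L.diag, L.circ, L.bias + c⟩], c, fun x hx => ?_⟩
  have : DCNetwork.eval [⟨L.diag, L.circ, L.bias + c⟩] x = L.weight.mulVec x + L.bias + c := by
    ext i
    rw [add_assoc]
    change complexReLU (L.weight.mulVec x i + (L.bias i + ⟨M, M⟩)) =
      L.weight.mulVec x i + (L.bias i + ⟨M, M⟩)
    rw [← add_assoc]
    exact complexReLU_add_of_norm_le ((norm_le_pi_norm _ i).trans (hM _ ⟨x, hx, rfl⟩))
  rw [this, sub_self, norm_zero]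
  exact hε

variable [NeZero m]

theorem weight_one_single (b : Fin m → ℂ) : (⟨1, Pi.single 0 1, b⟩ : DCLayer m).weight = 1 := by
  obtain ⟨k, rfl⟩ := Nat.exists_eq_succ_of_ne_zero (NeZero.ne m)
  have := Matrix.circulant_single_one ℂ (Fin (k + 1))
  simp [DCLayer.weight, this]

theorem add_const (b : Fin m → ℂ) : DCApproximable fun x => x + b := by
  have := affine (⟨1, Pi.single 0 1, b⟩ : DCLayer m)
  rw [weight_one_single] at this
  simpa using this

theorem diagonal (d : Fin m → ℂ) : DCApproximable fun x => d * x := by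
  have := affine (⟨d, Pi.single 0 1, 0⟩ : DCLayer m)
  have hw : (⟨d, Pi.single 0 1, 0⟩ : DCLayer m).weight = Matrix.diagonal d := by
    have h1 := weight_one_single (m := m) 0
    simp only [DCLayer.weight, Matrix.diagonal_one', one_mul] at h1 ⊢
    rw [h1, mul_one]
  rw [hw] at this
  convert this using 2 with x
  ext i
  simp [Matrix.mulVec_diagonal]

/-- The weighted shifts. -/
theorem add_shift (τ : ℂ) (k : Fin m) : DCApproximable fun x i => x i + τ * x (i - k) := by
  have := affine (⟨1, Pi.single 0 1 + Pi.single k τ, 0⟩ : DCLayer m)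
  convert this using 2 with x
  have h1 := weight_one_single (m := m) 0
  simp only [DCLayer.weight, Matrix.diagonal_one', one_mul] at h1 ⊢
  rw [Matrix.circulant_add, h1, Matrix.add_mulVec, Matrix.one_mulVec, add_zero]
  ext i
  simp only [Pi.add_apply, Matrix.mulVec, dotProduct, Matrix.circulant_apply]
  rw [Finset.sum_eq_single (i - k)]
  · simp
  · intro j _ hj
    rw [Pi.single_eq_of_ne, zero_mul]
    rintro rfl
    simp at hj
  · simp

/-- The transvections. -/
theorem transvection {i j : Fin m} (hij : i ≠ j) (τ : ℂ) :
    DCApproximable fun x => Function.update x i (x i + τ * x j) := by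
  refine of_forall_exists_near (by fun_prop) fun K hK ε hε => ?_
  obtain ⟨M, hMpos, hM⟩ := hK.isBounded.exists_pos_norm_le
  obtain ⟨s, hs, hs1, hsε⟩ : ∃ s : ℝ, 0 < s ∧ s ≤ 1 ∧ s * (‖τ‖ * M) < ε := by
    have hτ : 0 < ‖τ‖ * M + 1 := by positivity
    refine ⟨min 1 (ε / (‖τ‖ * M + 1)), lt_min one_pos (div_pos hε hτ), min_le_left _ _, ?_⟩
    calc _ ≤ ε / (‖τ‖ * M + 1) * (‖τ‖ * M) := by gcongr; exact min_le_right _ _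
      _ < ε / (‖τ‖ * M + 1) * (‖τ‖ * M + 1) := by
        have := div_pos hε hτ
        gcongr
        linarith
      _ = ε := div_mul_cancel₀ _ hτ.ne'
  have hs0 : (s : ℂ) ≠ 0 := by exact_mod_cast hs.ne'
  -- Conjugating the shift by a scaling of coordinate `i`: the factor `s⁻¹` restores the full `τ * x
  -- j` there, while the other coordinates change only by `O(s)`.
  let d : Fin m → ℂ := Function.update 1 i (s : ℂ)⁻¹
  let e : Fin m → ℂ := Function.update 1 i (s : ℂ)
  have hde : ∀ l, d l * e l = 1 := fun l => by
    by_cases h : l = i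
    · subst h; simp [d, e, hs0]
    · simp [d, e, h]
  have he : ∀ l, ‖e l‖ ≤ 1 := fun l => by
    by_cases h : l = i
    · subst h; simpa [e, abs_of_pos hs] using hs1
    · simp [e, h]
  refine ⟨_, (diagonal d).comp ((add_shift (s * τ) (i - j)).comp (diagonal e)), fun x hx => ?_⟩
  refine ((pi_norm_le_iff_of_nonneg (by positivity)).2 fun l => ?_).trans_lt hsε
  have hexp : d l * (e l * x l + s * τ * (e (l - (i - j)) * x (l - (i - j))))
      = x l + d l * s * τ * e (l - (i - j)) * x (l - (i - j)) := by
    linear_combination x l * hde l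
  simp only [Pi.sub_apply, Pi.mul_apply]
  rw [hexp]
  by_cases h : l = i
  · subst h
    simp [d, e, hij.symm, hs0]
    positivity
  · have hd : d l = 1 := by simp [d, h]
    rw [Function.update_of_ne h, add_sub_cancel_left, hd, one_mul, norm_mul, norm_mul, norm_mul,
      Complex.norm_of_nonneg hs.le, mul_assoc, mul_assoc]
    have hx' : ‖x (l - (i - j))‖ ≤ M := (norm_le_pi_norm x _).trans (hM x hx)
    gcongr
    calc _ ≤ 1 * M := mul_le_mul (he _) hx' (norm_nonneg _) zero_le_one
      _ = M := one_mul M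

/-- The bias protects every coordinate except `j` from ρ. -/
theorem relu_update (j : Fin m) :
    DCApproximable fun x => Function.update x j (complexReLU (x j)) := by
  refine ⟨continuous_id.update j (continuous_complexReLU.comp (continuous_apply j)),
    fun K hK ε hε => ?_⟩
  obtain ⟨M, hM⟩ := hK.isBounded.exists_norm_le
  let c : Fin m → ℂ := Function.update (fun _ => ⟨M, M⟩) j 0
  refine ⟨[⟨1, Pi.single 0 1, c⟩], c, fun x hx => ?_⟩
  have : DCNetwork.eval [⟨1, Pi.single 0 1, c⟩] x
      = Function.update x j (complexReLU (x j)) + c := by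
    ext l
    rw [DCNetwork.eval_singleton, DCLayer.apply, weight_one_single, Matrix.one_mulVec,
      Pi.add_apply, Pi.add_apply]
    by_cases h : l = j
    · subst h; simp [c]
    · simp only [c, Function.update_of_ne h]
      exact complexReLU_add_of_norm_le ((norm_le_pi_norm x l).trans (hM x hx))
  rw [this, sub_self, norm_zero]
  exact hε

theorem update_zero (j : Fin m) : DCApproximable fun x => Function.update x j 0 := by
  convert diagonal (Function.update 1 j 0 : Fin m → ℂ) using 2 with x
  ext l
  by_cases h : l = j
  · subst h; simp
  · simp [h]

theorem update_add_sum {ι : Type*} (j : Fin m) (s : Finset ι) (w : ι → ℂ) (r : ι → Fin m)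
    (hr : ∀ i, r i ≠ j) :
    DCApproximable fun x => Function.update x j (x j + ∑ i ∈ s, w i * x (r i)) := by
  classical
  induction s using Finset.induction_on with
  | empty => simpa using add_const (m := m) 0
  | insert a s ha ih =>
    convert (transvection (hr a).symm (w a)).comp ih using 2 with x
    simp only [Function.update_self, Function.update_of_ne (hr a), Function.update_idem,
      Finset.sum_insert ha]
    congr 1
    ring

end DCApproximable

/-! ### Accumulating functions in a register -/

/-- The functions of the first `n` coordinates which can be added to the last coordinate, up to
clearing the coordinate `n + 1`. -/
def DCAccumulable {n : ℕ} (φ : (Fin n → ℂ) → ℂ) : Prop :=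
  DCApproximable fun x : Fin (n + 3) → ℂ =>
    Function.update (Function.update x (Fin.natAdd n 1) 0) (Fin.natAdd n 2)
      (x (Fin.natAdd n 2) + φ fun i => x (Fin.castAdd 3 i))

namespace DCAccumulable

variable {n : ℕ}

theorem castAdd_ne_natAdd (i : Fin n) (k : Fin 3) : Fin.castAdd 3 i ≠ Fin.natAdd n k := by
  intro h
  have := congrArg Fin.val h
  simp at this
  omega

theorem natAdd_two_ne_natAdd_one : Fin.natAdd n (2 : Fin 3) ≠ Fin.natAdd n 1 := by
  intro h
  have := congrArg Fin.val h
  simp at this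

theorem zero : DCAccumulable (0 : (Fin n → ℂ) → ℂ) := by
  unfold DCAccumulable
  convert DCApproximable.update_zero (Fin.natAdd n (1 : Fin 3)) using 2 with x
  rw [Pi.zero_apply, add_zero, Function.update_eq_iff]
  exact ⟨(Function.update_of_ne natAdd_two_ne_natAdd_one _ _).symm, fun _ _ => rfl⟩

theorem add {φ ψ : (Fin n → ℂ) → ℂ} (hφ : DCAccumulable φ) (hψ : DCAccumulable ψ) :
    DCAccumulable (φ + ψ) := by
  unfold DCAccumulable
  convert DCApproximable.comp hφ hψ using 2 with x
  ext l
  by_cases h₂ : l = Fin.natAdd n 2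
  · subst h₂
    simp [castAdd_ne_natAdd]
    ring
  · by_cases h₁ : l = Fin.natAdd n 1
    · subst h₁
      simp [h₂]
    · simp [h₁, h₂]

/-- The scratch register is cleared, filled with the affine form, rectified, added to the
accumulator with factor `a`, and cleared again. -/
theorem relu (a : ℂ) (w : Fin n → ℂ) (b : ℂ) :
    DCAccumulable fun z => a * complexReLU (w ⬝ᵥ z + b) := by
  have hne := natAdd_two_ne_natAdd_one (n := n)
  unfold DCAccumulable
  have h₁ := DCApproximable.update_zero (Fin.natAdd n (1 : Fin 3))
  have h₂ := DCApproximable.update_add_sum (Fin.natAdd n (1 : Fin 3)) Finset.univ w (Fin.castAdd 3)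
    fun i => castAdd_ne_natAdd i 1
  have h₃ := DCApproximable.add_const (Pi.single (Fin.natAdd n (1 : Fin 3)) b)
  have h₄ := DCApproximable.relu_update (Fin.natAdd n (1 : Fin 3))
  have h₅ := DCApproximable.transvection hne a
  convert h₁.comp (h₅.comp (h₄.comp (h₃.comp (h₂.comp h₁)))) using 2 with x
  ext l
  by_cases hl₂ : l = Fin.natAdd n 2
  · subst hl₂
    simp [castAdd_ne_natAdd, dotProduct, hne]
  · by_cases hl₁ : l = Fin.natAdd n 1
    · subst hl₁
      simp [hl₂]
    · simp [hl₁, hl₂]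

/-- Each function in the span of the ReLU ridge functions extends to a function which can be
accumulated. -/
theorem exists_of_mem_reluSpan {g : C(unitCube n, ℝ)} (hg : g ∈ reluSpan n) :
    ∃ φ : (Fin n → ℂ) → ℂ, DCAccumulable φ ∧ ∀ x : unitCube n, φ (fun i => (x.1 i : ℂ)) = g x := by
  -- Quantifying over multiples lets the scalar case of the induction be absorbed into `a`.
  suffices h : ∀ a : ℝ, ∃ φ : (Fin n → ℂ) → ℂ, DCAccumulable φ ∧
      ∀ x : unitCube n, φ (fun i => (x.1 i : ℂ)) = (a * g x : ℝ) by
    simpa using h 1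
  induction hg using Submodule.span_induction with
  | mem g hg =>
    obtain ⟨⟨w, b⟩, rfl⟩ := hg
    refine fun a => ⟨_, relu a (fun i => w i) b, fun x => ?_⟩
    have : ((fun i => (w i : ℂ)) ⬝ᵥ (fun i => (x.1 i : ℂ))) + (b : ℂ)
        = ((w ⬝ᵥ x.1 + b : ℝ) : ℂ) := by
      simp [dotProduct]
    rw [this, complexReLU_ofReal, Complex.ofReal_mul]
    rfl
  | zero => exact fun a => ⟨0, zero, fun x => by simp⟩
  | add g h _ _ hg hh =>
    intro a
    obtain ⟨φ, hφ, hφg⟩ := hg a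
    obtain ⟨ψ, hψ, hψh⟩ := hh a
    exact ⟨φ + ψ, hφ.add hψ, fun x => by simp [hφg, hψh, mul_add]⟩
  | smul c g _ hg =>
    intro a
    obtain ⟨φ, hφ, hφg⟩ := hg (a * c)
    exact ⟨φ, hφ, fun x => by simp [hφg, mul_assoc]⟩

/-- An accumulable function is computed in the first coordinate by an approximable map. -/
theorem exists_dcApproximable {φ : (Fin n → ℂ) → ℂ} (hφ : DCAccumulable φ) :
    ∃ g : (Fin (n + 3) → ℂ) → Fin (n + 3) → ℂ, DCApproximable g ∧
      ∀ x, g x 0 = φ fun i => x (Fin.castAdd 3 i) := by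
  have hne : (0 : Fin (n + 3)) ≠ Fin.natAdd n 2 := by
    intro h
    have := congrArg Fin.val h
    simp at this
  -- Coordinate `0` may be an input, so it is overwritten only after the accumulation.
  refine ⟨_, (DCApproximable.transvection hne 1).comp ((DCApproximable.update_zero 0).comp
    (hφ.comp (DCApproximable.update_zero (Fin.natAdd n 2)))), fun x => ?_⟩
  simp [castAdd_ne_natAdd, hne.symm]

end DCAccumulable

/-! ### The approximation theorem -/

theorem norm_complexReLU_sub_le (z w : ℂ) : ‖complexReLU z - complexReLU w‖ ≤ ‖z - w‖ := by
  rw [complexReLU_eq, complexReLU_eq, Complex.norm_eq_sqrt_sq_add_sq,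
    Complex.norm_eq_sqrt_sq_add_sq]
  have h : ∀ a b : ℝ, (max 0 a - max 0 b) ^ 2 ≤ (a - b) ^ 2 := fun a b =>
    sq_le_sq.2 (by simpa using abs_max_sub_max_le_max 0 a 0 b)
  exact Real.sqrt_le_sqrt (add_le_add (h _ _) (h _ _))

theorem mainTheorem4 (n : ℕ) (f : (Fin n → ℝ) → ℝ)
    (hf : ContinuousOn f (Set.Icc 0 1)) (hf0 : ∀ x ∈ Set.Icc (0 : Fin n → ℝ) 1, 0 ≤ f x)
    (ε : ℝ) (hε : 0 < ε) :
    ∃ N : DCNetwork (n + 3), 1 ≤ N.length ∧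
      ∀ x ∈ Set.Icc (0 : Fin (n + 3) → ℝ) 1,
        ‖((f (fun i : Fin n => x (Fin.castAdd 3 i)) : ℝ) : ℂ)
            - N.eval (fun i => (x i : ℂ)) 0‖ < ε := by
  let F : C(unitCube n, ℝ) := ⟨(Set.Icc 0 1).domRestrict f, hf.domRestrict⟩
  have hF : F ∈ closure (reluSpan n : Set C(unitCube n, ℝ)) := by
    rw [← Submodule.topologicalClosure_coe, topologicalClosure_reluSpan]
    trivial
  obtain ⟨p, hp, hFp⟩ := Metric.mem_closure_iff.1 hF (ε / 2) (half_pos hε)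
  obtain ⟨φ, hφ, hφp⟩ := DCAccumulable.exists_of_mem_reluSpan hp
  obtain ⟨g, hg, hgφ⟩ := hφ.exists_dcApproximable
  have hcont : Continuous fun (x : Fin (n + 3) → ℝ) i => (x i : ℂ) := by fun_prop
  obtain ⟨N, c, hN⟩ := hg.exists_eval_near _
    ((isCompact_Icc (a := (0 : Fin (n + 3) → ℝ)) (b := 1)).image hcont) (ε / 2) (half_pos hε)
  -- The extra layer removes the translation `c` and makes the depth positive.
  refine ⟨N ++ [⟨1, Pi.single 0 1, -c⟩], by simp, fun x hx => ?_⟩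
  have hx' : (fun i : Fin n => x (Fin.castAdd 3 i)) ∈ Set.Icc (0 : Fin n → ℝ) 1 :=
    ⟨fun i => hx.1 _, fun i => hx.2 _⟩
  have hy : F ⟨_, hx'⟩ = f fun i => x (Fin.castAdd 3 i) := rfl
  have hFg : ‖((f fun i => x (Fin.castAdd 3 i) : ℝ) : ℂ) - g (fun i => (x i : ℂ)) 0‖ < ε / 2 := by
    rw [hgφ, hφp ⟨_, hx'⟩, ← hy, ← Complex.ofReal_sub, Complex.norm_real, ← dist_eq_norm]
    exact (ContinuousMap.dist_apply_le_dist _).trans_lt hFp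
  have hgN : ‖g (fun i => (x i : ℂ)) 0 - (N.eval (fun i => (x i : ℂ)) 0 - c 0)‖ < ε / 2 := by
    rw [norm_sub_rev, sub_sub, add_comm (c 0)]
    exact (norm_le_pi_norm (N.eval (fun i => (x i : ℂ)) - (g (fun i => (x i : ℂ)) + c)) 0).trans_lt
      (hN _ ⟨x, hx, rfl⟩)
  have heval : (N ++ [⟨1, Pi.single 0 1, -c⟩] : DCNetwork (n + 3)).eval (fun i => (x i : ℂ)) 0
      = complexReLU (N.eval (fun i => (x i : ℂ)) 0 - c 0) := by
    rw [DCNetwork.eval_append, DCNetwork.eval_singleton, DCLayer.apply,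
      DCApproximable.weight_one_single, Matrix.one_mulVec, Pi.add_apply, sub_eq_add_neg]
    rfl
  -- Since `f` is nonnegative it is fixed by ρ, and ρ is 1-Lipschitz.
  rw [heval, ← max_eq_right (hf0 _ hx'), ← complexReLU_ofReal]
  refine (norm_complexReLU_sub_le _ _).trans_lt ?_
  calc _ ≤ _ := norm_sub_le_norm_sub_add_norm_sub _ (g (fun i => (x i : ℂ)) 0) _
    _ < ε / 2 + ε / 2 := add_lt_add hFg hgN
    _ = ε := add_halves ε

end
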